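/- For real $z,a,b$ with $a>-1$ let $$W(z,a,b)=\sum_{n=0}^{\infty}\frac{z^n}{n!\,\Gamma(an+b)}$$ be the Wright function (where $1/\Gamma$ is read as $0$ at the poles of $\Gamma$), and for $0<\nu<1$ let $M_\nu(x)=W(-x,-\nu,1-\nu)$ be the Mainardi function. If $0<\alpha<1$, then $M_{\alpha/2}$ is positive and strictly decreasing on $[0,\infty)$; that is, $M_{\alpha/2}(x)>0$ for all $x\ge 0$, and $M_{\alpha/2}(x)>M_{\alpha/2}(y)$ whenever $0\le x<y$. -/

import Mathlib

/-- The Wright function `W(z, a, b) = ∑ zⁿ / (n! Γ(a n + b))` of a real variable `z` with real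
parameters `a`, `b`. At the poles of `Γ` (the non-positive integers) the term is `0`, as usual for
the entire function `1 / Γ`: Mathlib sets `Real.Gamma` to `0` there, and `x / 0 = 0`. -/
noncomputable def wright (z a b : ℝ) : ℝ :=
  ∑' n : ℕ, z ^ n / ((n.factorial : ℝ) * Real.Gamma (a * (n : ℝ) + b))

/-- The Mainardi function `M_ν(x) = W(-x, -ν, 1 - ν)` of a real variable `x`. -/
noncomputable def mainardi (ν x : ℝ) : ℝ :=
  wright (-x) (-ν) (1 - ν)

open Filter Topology

/-! For `b ≥ 0`, `W(-x, -ν, b)` is the inverse Laplace transform at time 1 of `F s = s ^ (-b) * exp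
(-x * s ^ ν)`, which is completely monotone, so it should be nonnegative. To see this without
integrals, replace `1/Γ` by Euler's approximation `1/GammaSeq _ n`: the series becomes a positive
multiple of `(-1)^(n+1) F^(n+1)(n)`, and dominated convergence lets `n → ∞`. For `ν ≤ 1/2` the
majorant exists because `1/Γ(b - νk)` grows at most like `√k!`, up to a geometric factor and a shift
of `k`, against the `1/k!` of the series.

Differentiation in `z` replaces `b` by `b - ν`, so nonnegativity yields monotonicity. Analyticity
makes it strict, and then `M(x) > M(x + 1) ≥ 0`. -/

lemma Real.tendsto_inv_GammaSeq (c : ℝ) :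
    Tendsto (fun n ↦ (Real.GammaSeq c n)⁻¹) atTop (𝓝 (Real.Gamma c)⁻¹) := by
  by_cases h : ∃ m : ℕ, c = -m
  · obtain ⟨m, rfl⟩ := h
    rw [Real.Gamma_neg_nat_eq_zero, inv_zero]
    -- At a pole, the product contains the factor `-m + m = 0` as soon as `n ≥ m`, so the sequence
    -- is eventually 0.
    refine tendsto_const_nhds.congr' ?_
    filter_upwards [eventually_ge_atTop m] with n hn
    have : ∏ j ∈ Finset.range (n + 1), (-(m : ℝ) + j) = 0 :=
      Finset.prod_eq_zero (i := m) (Finset.mem_range.2 (by omega)) (by simp)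
    simp [Real.GammaSeq, this]
  · push Not at h
    exact (Real.GammaSeq_tendsto_Gamma c).inv₀ (Real.Gamma_ne_zero h)

lemma Real.inv_GammaSeq (c : ℝ) (n : ℕ) :
    (Real.GammaSeq c n)⁻¹ =
      (∏ j ∈ Finset.range (n + 1), (c + j)) * (n : ℝ) ^ (-c) / n.factorial := by
  rw [Real.GammaSeq, inv_div, Real.rpow_neg (Nat.cast_nonneg n)]
  field_simp

/-- Multiplying the factor from `n` to `n + 1` in Euler's product for `1 / Γ`. -/
lemma one_add_div_mul_rpow_le {c K : ℝ} {n : ℕ} (hn : 1 ≤ n) (hK : |c| ≤ K) :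
    (1 + c / (n + 1)) * ((n : ℝ) / (n + 1)) ^ c ≤ Real.exp (K / n - K / (n + 1)) := by
  have hn0 : (0 : ℝ) < n := by exact_mod_cast hn
  have hq : (0 : ℝ) < n / (n + 1) := by positivity
  have hK0 : 0 ≤ K := (abs_nonneg c).trans hK
  have h1 : 1 + c / (n + 1) ≤ Real.exp (c / (n + 1)) := by
    linarith [Real.add_one_le_exp (c / ((n : ℝ) + 1))]
  have h2 : Real.log (n / (n + 1)) ≤ -(1 / (n + 1)) := by
    have := Real.log_le_sub_one_of_pos hq
    have e : (n : ℝ) / (n + 1) - 1 = -(1 / (n + 1)) := by field_simp; ring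
    linarith
  have h3 : -(1 / (n : ℝ)) ≤ Real.log (n / (n + 1)) := by
    have := Real.one_sub_inv_le_log_of_pos hq
    have e : 1 - ((n : ℝ) / (n + 1))⁻¹ = -(1 / n) := by field_simp; ring
    linarith
  have hd : 0 ≤ 1 / (n : ℝ) - 1 / (n + 1) := by
    rw [sub_nonneg]; exact one_div_le_one_div_of_le hn0 (by linarith)
  calc (1 + c / (n + 1)) * ((n : ℝ) / (n + 1)) ^ c
      ≤ Real.exp (c / (n + 1)) * ((n : ℝ) / (n + 1)) ^ c := by gcongr
    _ = Real.exp (c / (n + 1) + Real.log (n / (n + 1)) * c) := by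
        rw [Real.rpow_def_of_pos hq, ← Real.exp_add]
    _ ≤ Real.exp (K / n - K / (n + 1)) := by
        apply Real.exp_le_exp.2
        have e1 : c / ((n : ℝ) + 1) = c * (1 / (n + 1)) := by ring
        have e2 : K / (n : ℝ) - K / (n + 1) = K * (1 / n - 1 / (n + 1)) := by ring
        rw [e1, e2]
        obtain ⟨hl, hr⟩ := abs_le.1 hK
        rcases le_total 0 c with h | h
        · nlinarith [mul_nonneg hK0 hd]
        · nlinarith

/-- The exponent is a difference, so iterating telescopes. `K ≤ n` keeps `1 + c / (n + 1)`
nonnegative. -/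
lemma abs_inv_GammaSeq_succ_le {c K : ℝ} {n : ℕ} (hn : 1 ≤ n) (hK : |c| ≤ K) (hKn : K ≤ n) :
    |(Real.GammaSeq c (n + 1))⁻¹| ≤
      |(Real.GammaSeq c n)⁻¹| * Real.exp (K / n - K / (n + 1)) := by
  have hn0 : (0 : ℝ) < n := by exact_mod_cast hn
  have hpos : 0 ≤ 1 + c / ((n : ℝ) + 1) := by
    have : -1 ≤ c / ((n : ℝ) + 1) := by
      rw [le_div_iff₀ (by positivity)]
      linarith [neg_abs_le c]
    linarith
  have key : (Real.GammaSeq c (n + 1))⁻¹ =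
      (Real.GammaSeq c n)⁻¹ * ((1 + c / (n + 1)) * ((n : ℝ) / (n + 1)) ^ c) := by
    rw [Real.inv_GammaSeq, Real.inv_GammaSeq, Finset.prod_range_succ _ (n + 1),
      Real.div_rpow hn0.le (by positivity), Real.rpow_neg hn0.le, Real.rpow_neg (by positivity),
      Nat.factorial_succ]
    have : (n : ℝ) ^ c ≠ 0 := (Real.rpow_pos_of_pos hn0 c).ne'
    have : ((n : ℝ) + 1) ^ c ≠ 0 := (Real.rpow_pos_of_pos (by positivity) c).ne'
    push_cast
    field_simp
    ring
  rw [key, abs_mul]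
  gcongr
  rw [abs_of_nonneg (by positivity)]
  exact one_add_div_mul_rpow_le hn hK

lemma abs_inv_GammaSeq_le_of_le {c : ℝ} {K n : ℕ} (hK : |c| ≤ K) (hn : 1 ≤ n) (hnK : n ≤ K) :
    |(Real.GammaSeq c n)⁻¹| ≤ Real.exp (5 * K) * K.factorial := by
  have hn0 : (0 : ℝ) < n := by exact_mod_cast hn
  have hK1 : (1 : ℝ) ≤ K := by exact_mod_cast hn.trans hnK
  have hnK' : (n : ℝ) ≤ K := by exact_mod_cast hnK
  rw [Real.inv_GammaSeq, abs_div, abs_mul, Finset.abs_prod,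
    abs_of_nonneg (Real.rpow_nonneg hn0.le _), Nat.abs_cast]
  have h1 : ∏ j ∈ Finset.range (n + 1), |c + j| ≤ (2 * K : ℝ) ^ (n + 1) := by
    calc ∏ j ∈ Finset.range (n + 1), |c + j| ≤ ∏ j ∈ Finset.range (n + 1), (2 * K : ℝ) := by
          refine Finset.prod_le_prod (fun _ _ ↦ abs_nonneg _) fun j hj ↦ ?_
          have : (j : ℝ) ≤ K := by
            exact_mod_cast (Nat.lt_succ_iff.1 (Finset.mem_range.1 hj)).trans hnK
          calc |c + j| ≤ |c| + |(j : ℝ)| := abs_add_le _ _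
            _ ≤ 2 * K := by rw [Nat.abs_cast]; linarith
      _ = _ := by simp
  have h2 : (n : ℝ) ^ (-c) ≤ (K : ℝ) ^ K := by
    calc (n : ℝ) ^ (-c) ≤ (n : ℝ) ^ (K : ℝ) :=
          Real.rpow_le_rpow_of_exponent_le (by exact_mod_cast hn) ((neg_le_abs c).trans hK)
      _ = (n : ℝ) ^ K := Real.rpow_natCast _ _
      _ ≤ (K : ℝ) ^ K := by gcongr
  have h3 : (2 * K : ℝ) ^ n / n.factorial ≤ Real.exp (2 * K) :=
    Real.pow_div_factorial_le_exp (2 * K) (by positivity) n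
  have h4 : (K : ℝ) ^ K ≤ Real.exp K * K.factorial := by
    rw [← div_le_iff₀ (by positivity)]
    exact Real.pow_div_factorial_le_exp K (by positivity) K
  have h5 : (2 * K : ℝ) ≤ Real.exp (2 * K) := by linarith [Real.add_one_le_exp (2 * K : ℝ)]
  calc (∏ j ∈ Finset.range (n + 1), |c + j|) * (n : ℝ) ^ (-c) / n.factorial
      ≤ (2 * K : ℝ) ^ (n + 1) * (K : ℝ) ^ K / n.factorial := by gcongr
    _ = (2 * K) * ((2 * K : ℝ) ^ n / n.factorial) * (K : ℝ) ^ K := by ring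
    _ ≤ Real.exp (2 * K) * Real.exp (2 * K) * (Real.exp K * K.factorial) := by gcongr
    _ = Real.exp (5 * K) * K.factorial := by
        rw [← mul_assoc, ← Real.exp_add, ← Real.exp_add]; ring_nf

/-- A bound for Euler's approximations of `1 / Γ`, uniform in the index. -/
lemma abs_inv_GammaSeq_le {c : ℝ} {K n : ℕ} (hK : |c| ≤ K) (hK1 : 1 ≤ K) (hn : 1 ≤ n) :
    |(Real.GammaSeq c n)⁻¹| ≤ Real.exp (6 * K) * K.factorial := by
  have h56 : Real.exp (5 * K) * K.factorial ≤ Real.exp (6 * K) * K.factorial := by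
    gcongr; norm_num
  rcases le_total n K with h | h
  · exact (abs_inv_GammaSeq_le_of_le hK hn h).trans h56
  have hK0 : (1 : ℝ) ≤ K := by exact_mod_cast hK1
  -- Telescoping from `K` to `n` leaves the exponent `K / K - K / n`.
  have main : |(Real.GammaSeq c n)⁻¹| ≤
      |(Real.GammaSeq c K)⁻¹| * Real.exp (1 - (K : ℝ) / n) := by
    induction n, h using Nat.le_induction with
    | base => rw [div_self (by positivity)]; simp
    | succ n hKn ih =>
      refine (abs_inv_GammaSeq_succ_le (hK1.trans hKn) hK (by exact_mod_cast hKn)).trans ?_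
      refine (mul_le_mul_of_nonneg_right (ih (hK1.trans hKn)) (Real.exp_pos _).le).trans_eq ?_
      rw [mul_assoc, ← Real.exp_add]
      push_cast
      ring_nf
  calc |(Real.GammaSeq c n)⁻¹| ≤ |(Real.GammaSeq c K)⁻¹| * Real.exp (1 - (K : ℝ) / n) := main
    _ ≤ (Real.exp (5 * K) * K.factorial) * Real.exp K := by
        gcongr
        · exact abs_inv_GammaSeq_le_of_le hK hK1 le_rfl
        · have : 0 ≤ (K : ℝ) / n := by positivity
          linarith
    _ = Real.exp (6 * K) * K.factorial := by
        rw [mul_right_comm, ← Real.exp_add]; ring_nf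

/-- The terms `(-1)ⁿ F⁽ⁿ⁾(s)` of the completely monotone function `F s = s ^ (-b) exp (-x s ^ ν)`,
expanded in powers of `x`, are non-negative. -/
lemma exists_hasSum_pochhammer_rpow {ν s x : ℝ} (hν0 : 0 ≤ ν) (hν1 : ν ≤ 1) (hs : 0 < s)
    (hx : 0 ≤ x) (n : ℕ) : ∀ b : ℝ, 0 ≤ b → ∃ S : ℝ, 0 ≤ S ∧
      HasSum (fun k : ℕ ↦ (-x) ^ k / k.factorial *
        ((∏ j ∈ Finset.range n, (b - ν * k + j)) * s ^ (-(b - ν * k)))) S := by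
  induction n with
  | zero =>
    intro b _
    refine ⟨Real.exp (-x * s ^ ν) * s ^ (-b), by positivity, ?_⟩
    have h := (NormedSpace.expSeries_div_hasSum_exp (-x * s ^ ν)).mul_right (s ^ (-b))
    rw [← Real.exp_eq_exp_ℝ] at h
    refine h.congr_fun fun k ↦ ?_
    rw [show -(b - ν * k) = ν * k + -b by ring, Real.rpow_add hs, Real.rpow_mul hs.le,
      Real.rpow_natCast, mul_pow]
    simp; ring
  | succ n ih =>
    intro b hb
    obtain ⟨S, hS0, hS⟩ := ih (b + 1) (by linarith)
    obtain ⟨T, hT0, hT⟩ := ih (b + 1 - ν) (by linarith)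
    -- Split the factor `b - ν * k` at `j = 0`: `b` leads to parameter `b + 1`, while `-ν * k`
    -- cancels against `k!` and, after an index shift, leads to `b + 1 - ν`, nonnegative as `ν ≤ 1`.
    -- This is the product rule for `-F'`.
    refine ⟨b * s * S + x * ν * s * T, by positivity, ?_⟩
    have hT' : HasSum (fun k : ℕ ↦ (-x) ^ k / k.factorial * ((-(ν * k)) *
        (∏ j ∈ Finset.range n, (b + 1 - ν * k + j)) * s ^ (-(b - ν * k)))) (x * ν * s * T) := by
      rw [← hasSum_nat_add_iff' 1]
      simp only [Finset.range_one, Finset.sum_singleton, Nat.cast_zero, mul_zero, neg_zero,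
        zero_mul, sub_zero]
      refine (hT.mul_left (x * ν * s)).congr_fun fun k ↦ ?_
      have e : s ^ (-(b - ν * ((k + 1 : ℕ) : ℝ))) = s ^ (-(b + 1 - ν - ν * k)) * s := by
        nth_rw 3 [← Real.rpow_one s]
        rw [← Real.rpow_add hs]; push_cast; ring_nf
      have e' : ∏ j ∈ Finset.range n, (b + 1 - ν * ((k + 1 : ℕ) : ℝ) + j) =
          ∏ j ∈ Finset.range n, (b + 1 - ν - ν * k + j) :=
        Finset.prod_congr rfl fun j _ ↦ by push_cast; ring
      rw [e, e', Nat.factorial_succ]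
      push_cast
      field_simp
      ring
    refine ((hS.mul_left (b * s)).add hT').congr_fun fun k ↦ ?_
    have e : s ^ (-(b - ν * k)) = s ^ (-(b + 1 - ν * k)) * s := by
      nth_rw 3 [← Real.rpow_one s]
      rw [← Real.rpow_add hs]; ring_nf
    have e' : ∏ j ∈ Finset.range n, (b - ν * k + ((j + 1 : ℕ) : ℝ)) =
        ∏ j ∈ Finset.range n, (b + 1 - ν * k + j) :=
      Finset.prod_congr rfl fun j _ ↦ by push_cast; ring
    rw [e, Finset.prod_range_succ', e']
    push_cast
    ring

lemma summable_pow_mul_sqrt_factorial_div_factorial {C : ℝ} (hC : 0 < C) (M : ℕ) :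
    Summable (fun k : ℕ ↦ C ^ k * √((k + M).factorial : ℝ) / k.factorial) := by
  refine summable_of_ratio_test_tendsto_lt_one (l := 0) one_pos
    (Eventually.of_forall fun k ↦ by positivity) ?_
  have h0 : Tendsto (fun k : ℕ ↦ C * √(1 / ((k : ℝ) + 1) + M * (1 / ((k : ℝ) + 1)) ^ 2))
      atTop (𝓝 (C * √(0 + M * 0 ^ 2))) := by
    have := tendsto_one_div_add_atTop_nhds_zero_nat (𝕜 := ℝ)
    exact ((this.add ((this.pow 2).const_mul _)).sqrt).const_mul C
  simp only [ne_eq, OfNat.ofNat_ne_zero, not_false_eq_true, zero_pow, mul_zero, add_zero,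
    Real.sqrt_zero] at h0
  refine h0.congr fun k ↦ ?_
  have hk : (0 : ℝ) < k + 1 := by positivity
  have e : √(1 / ((k : ℝ) + 1) + M * (1 / ((k : ℝ) + 1)) ^ 2) =
      √((k : ℝ) + M + 1) / (k + 1) := by
    rw [show 1 / ((k : ℝ) + 1) + M * (1 / ((k : ℝ) + 1)) ^ 2 =
      (k + M + 1) / (k + 1) ^ 2 by field_simp; ring, Real.sqrt_div (by positivity),
      Real.sqrt_sq hk.le]
  have hs : √((k + M).factorial : ℝ) ≠ 0 := by positivity
  rw [e, Real.norm_of_nonneg (by positivity), Real.norm_of_nonneg (by positivity),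
    show k + 1 + M = (k + M) + 1 by ring, Nat.factorial_succ, Nat.factorial_succ]
  push_cast
  rw [Real.sqrt_mul (by positivity)]
  field_simp
  ring

/-- A summable majorant for the Wright series and its Euler approximations. -/
lemma exists_summable_wright_bound {ν : ℝ} (hν0 : 0 ≤ ν) (hν1 : ν ≤ 1 / 2) (b r : ℝ) :
    ∃ u : ℕ → ℝ, Summable u ∧ ∀ (k n : ℕ), 1 ≤ n → ∀ z : ℝ, |z| ≤ r →
      |z ^ k / k.factorial * (Real.GammaSeq (-ν * k + b) n)⁻¹| ≤ u k := by
  obtain ⟨L, hL⟩ := exists_nat_ge (|b| + 1)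
  have hL1 : 1 ≤ L := by
    have : (1 : ℝ) ≤ L := by linarith [abs_nonneg b]
    exact_mod_cast this
  set C : ℝ := (|r| + 1) * Real.exp 3 with hC
  refine ⟨fun k ↦ Real.exp (6 * L) * (C ^ k * √((k + 2 * L).factorial : ℝ) / k.factorial),
    (summable_pow_mul_sqrt_factorial_div_factorial (by positivity) _).mul_left _, ?_⟩
  intro k n hn z hz
  -- The 1 added to `|b|` in `L` absorbs the rounding in `k / 2`; `2 * K ≤ k + 2 * L` gives `K!² ≤
  -- (k + 2 * L)!`.
  set K := k / 2 + L with hKdef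
  have hK2 : 2 * K ≤ k + 2 * L := by omega
  have hK2' : (k : ℝ) ≤ 2 * (k / 2 : ℕ) + 1 := by
    exact_mod_cast (by omega : k ≤ 2 * (k / 2) + 1)
  have hcK : |-ν * k + b| ≤ K := by
    calc |-ν * k + b| ≤ |-ν * k| + |b| := abs_add_le _ _
      _ = ν * k + |b| := by rw [abs_mul, abs_neg, abs_of_nonneg hν0, Nat.abs_cast]
      _ ≤ 1 / 2 * k + |b| := by gcongr
      _ ≤ K := by rw [hKdef]; push_cast; linarith
  have hfac : (K.factorial : ℝ) ≤ √((k + 2 * L).factorial : ℝ) := by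
    apply Real.le_sqrt_of_sq_le
    have h1 : K.factorial * K.factorial ≤ (K + K).factorial :=
      Nat.le_of_dvd (Nat.factorial_pos _) (Nat.factorial_mul_factorial_dvd_factorial_add K K)
    have h2 : (K + K).factorial ≤ (k + 2 * L).factorial := Nat.factorial_le (by omega)
    rw [sq]
    exact_mod_cast h1.trans h2
  have hexp : Real.exp (6 * K) ≤ Real.exp (6 * L) * Real.exp 3 ^ k := by
    rw [← Real.exp_nat_mul, ← Real.exp_add]
    apply Real.exp_le_exp.2
    have : (2 * K : ℝ) ≤ k + 2 * L := by exact_mod_cast hK2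
    linarith
  have hz' : |z| ≤ |r| + 1 := hz.trans ((le_abs_self r).trans (by linarith))
  rw [abs_mul, abs_div, abs_pow, Nat.abs_cast]
  calc |z| ^ k / k.factorial * |(Real.GammaSeq (-ν * k + b) n)⁻¹|
      ≤ (|r| + 1) ^ k / k.factorial * ((Real.exp (6 * L) * Real.exp 3 ^ k) *
          √((k + 2 * L).factorial : ℝ)) := by
        gcongr
        refine (abs_inv_GammaSeq_le hcK (by omega) hn).trans ?_
        gcongr
    _ = _ := by simp only [hC, mul_pow]; ring

lemma exists_summable_wright_term_bound {ν : ℝ} (hν0 : 0 ≤ ν) (hν1 : ν ≤ 1 / 2) (b r : ℝ) :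
    ∃ u : ℕ → ℝ, Summable u ∧ ∀ (k : ℕ) (z : ℝ), |z| ≤ r →
      |z ^ k / (k.factorial * Real.Gamma (-ν * k + b))| ≤ u k := by
  obtain ⟨u, hu, h⟩ := exists_summable_wright_bound hν0 hν1 b r
  refine ⟨u, hu, fun k z hz ↦ ?_⟩
  have hlim := ((Real.tendsto_inv_GammaSeq (-ν * k + b)).const_mul (z ^ k / k.factorial)).abs
  rw [← div_eq_mul_inv, div_div] at hlim
  refine le_of_tendsto hlim ?_
  filter_upwards [eventually_ge_atTop 1] with n hn using h k n hn z hz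

lemma summable_wright {ν : ℝ} (hν0 : 0 ≤ ν) (hν1 : ν ≤ 1 / 2) (b z : ℝ) :
    Summable (fun k : ℕ ↦ z ^ k / (k.factorial * Real.Gamma (-ν * k + b))) := by
  obtain ⟨u, hu, h⟩ := exists_summable_wright_term_bound hν0 hν1 b |z|
  exact Summable.of_norm_bounded hu fun k ↦ h k z le_rfl

/-- The Wright function is the limit of the Post–Widder approximations of the inverse Laplace
transform of `s ^ (-b) exp (-x s ^ ν)`. -/
lemma wright_neg_nonneg {ν : ℝ} (hν0 : 0 ≤ ν) (hν1 : ν ≤ 1 / 2) {b x : ℝ} (hb : 0 ≤ b)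
    (hx : 0 ≤ x) : 0 ≤ wright (-x) (-ν) b := by
  obtain ⟨u, hu, h⟩ := exists_summable_wright_bound hν0 hν1 b |(-x)|
  have hlim : Tendsto (fun n : ℕ ↦
      ∑' k : ℕ, (-x) ^ k / k.factorial * (Real.GammaSeq (-ν * k + b) n)⁻¹) atTop
      (𝓝 (wright (-x) (-ν) b)) := by
    refine tendsto_tsum_of_dominated_convergence hu (fun k ↦ ?_) ?_
    · have := (Real.tendsto_inv_GammaSeq (-ν * k + b)).const_mul ((-x) ^ k / k.factorial)
      rwa [← div_eq_mul_inv, div_div] at this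
    · filter_upwards [eventually_ge_atTop 1] with n hn k using h k n hn (-x) le_rfl
  refine ge_of_tendsto hlim ?_
  filter_upwards [eventually_ge_atTop 1] with n hn
  obtain ⟨S, hS0, hS⟩ := exists_hasSum_pochhammer_rpow hν0 (by linarith)
    (show (0 : ℝ) < n by exact_mod_cast hn) hx (n + 1) b hb
  have : HasSum (fun k : ℕ ↦ (-x) ^ k / k.factorial * (Real.GammaSeq (-ν * k + b) n)⁻¹)
      (S / n.factorial) := by
    refine (hS.div_const _).congr_fun fun k ↦ ?_
    rw [Real.inv_GammaSeq, show -ν * k + b = b - ν * k by ring]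
    ring
  rw [this.tsum_eq]
  positivity

lemma hasDerivAt_wright {ν : ℝ} (hν0 : 0 ≤ ν) (hν1 : ν ≤ 1 / 2) (b z : ℝ) :
    HasDerivAt (fun z ↦ wright z (-ν) b) (wright z (-ν) (b - ν)) z := by
  set r : ℝ := |z| + 1
  obtain ⟨u, hu, h⟩ := exists_summable_wright_term_bound hν0 hν1 (b - ν) r
  have hterm : ∀ (k : ℕ) (y : ℝ), ((k + 1 : ℕ) : ℝ) * y ^ k /
      ((k + 1).factorial * Real.Gamma (-ν * ((k + 1 : ℕ) : ℝ) + b)) =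
      y ^ k / (k.factorial * Real.Gamma (-ν * k + (b - ν))) := fun k y ↦ by
    rw [Nat.factorial_succ, show -ν * ((k + 1 : ℕ) : ℝ) + b = -ν * k + (b - ν) by push_cast; ring,
      Nat.cast_mul, mul_assoc, mul_div_mul_left _ _ (by positivity)]
  let g' : ℕ → ℝ → ℝ := fun k y ↦
    (k : ℝ) * y ^ (k - 1) / (k.factorial * Real.Gamma (-ν * k + b))
  have hz : z ∈ Metric.ball (0 : ℝ) r := by simp [r]
  have key : HasDerivAt (fun z ↦ wright z (-ν) b) (∑' k, g' k z) z := by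
    -- The derivative kills the term `k = 0`, so the majorant is `u` shifted by one.
    refine hasDerivAt_tsum_of_isPreconnected (u := fun k ↦ Nat.casesOn k 0 u)
      (t := Metric.ball (0 : ℝ) r) (y₀ := z) ((summable_nat_add_iff 1).1 hu) Metric.isOpen_ball
      (convex_ball _ _).isPreconnected (fun k y _ ↦ (hasDerivAt_pow k y).div_const _)
      (fun k y hy ↦ ?_) hz (summable_wright hν0 hν1 b z) hz
    cases k with
    | zero => simp [g']
    | succ k =>
      simp only [g', Nat.add_sub_cancel, hterm]
      exact h k y (by simpa using (Metric.mem_ball.1 hy).le)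
  have hsum : HasSum (fun k ↦ g' k z) (wright z (-ν) (b - ν)) := by
    rw [← hasSum_nat_add_iff' 1]
    simp only [g', Nat.add_sub_cancel, hterm, Finset.range_one, Finset.sum_singleton,
      Nat.cast_zero, zero_mul, zero_div, sub_zero]
    exact (summable_wright hν0 hν1 (b - ν) z).hasSum
  rwa [hsum.tsum_eq] at key

lemma analyticOnNhd_wright {ν : ℝ} (hν0 : 0 ≤ ν) (hν1 : ν ≤ 1 / 2) (b : ℝ) :
    AnalyticOnNhd ℝ (fun z ↦ wright z (-ν) b) Set.univ := by
  let c : ℕ → ℝ := fun k ↦ 1 / (k.factorial * Real.Gamma (-ν * k + b))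
  let p := FormalMultilinearSeries.ofScalars ℝ c
  have hp : p.radius = ⊤ := by
    refine p.radius_eq_top_of_summable_norm fun r ↦ ?_
    refine (summable_wright hν0 hν1 b r).norm.congr fun k ↦ ?_
    rw [FormalMultilinearSeries.ofScalars_norm, div_eq_mul_one_div, norm_mul, mul_comm, norm_pow,
      Real.norm_of_nonneg r.coe_nonneg]
  have h := p.hasFPowerSeriesOnBall (by simp [hp])
  have hf : p.sum = fun z ↦ wright z (-ν) b := by
    funext z
    refine (FormalMultilinearSeries.ofScalars_sum_eq c z).trans (tsum_congr fun k ↦ ?_)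
    rw [smul_eq_mul, one_div_mul_eq_div]
  rw [hp, hf] at h
  simpa using h.analyticOnNhd

lemma strictAntiOn_wright_neg {ν : ℝ} (hν0 : 0 ≤ ν) (hν1 : ν < 1 / 2) {b : ℝ} (hb : ν < b) :
    StrictAntiOn (fun x ↦ wright (-x) (-ν) b) (Set.Ici 0) := by
  have hd : ∀ x, HasDerivAt (fun x ↦ wright (-x) (-ν) b) (-wright (-x) (-ν) (b - ν)) x := by
    intro x
    simpa [Function.comp_def] using
      (hasDerivAt_wright hν0 hν1.le b (-x)).comp x (hasDerivAt_neg x)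
  have hanti : AntitoneOn (fun x ↦ wright (-x) (-ν) b) (Set.Ici 0) := by
    refine antitoneOn_of_deriv_nonpos (convex_Ici 0)
      (fun x _ ↦ (hd x).continuousAt.continuousWithinAt)
      (fun x _ ↦ (hd x).differentiableAt.differentiableWithinAt) fun x hx ↦ ?_
    rw [interior_Ici] at hx
    rw [(hd x).deriv, neg_nonpos]
    exact wright_neg_nonneg hν0 hν1.le (by linarith) (Set.mem_Ioi.1 hx).le
  intro x hx y hy hxy
  refine lt_of_le_of_ne (hanti hx hy hxy.le) fun heq ↦ ?_
  have hx0 : (0 : ℝ) ≤ x := hx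
  have hconst : ∀ t ∈ Set.Ioo x y, wright (-t) (-ν) b = wright (-x) (-ν) b := fun t ht ↦
    le_antisymm (hanti hx (hx0.trans ht.1.le) ht.1.le)
      (heq.symm.le.trans (hanti (hx0.trans ht.1.le) hy ht.2.le))
  have hev : (fun z ↦ wright z (-ν) b) =ᶠ[𝓝 (-((x + y) / 2))]
      fun _ ↦ wright (-x) (-ν) b := by
    filter_upwards [Ioo_mem_nhds (show -y < -((x + y) / 2) by linarith)
      (show -((x + y) / 2) < -x by linarith)] with z hz
    simpa using hconst (-z) ⟨by linarith [hz.2], by linarith [hz.1]⟩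
  have hall : (fun z ↦ wright z (-ν) b) = fun _ ↦ wright (-x) (-ν) b :=
    (analyticOnNhd_wright hν0 hν1.le b).eq_of_eventuallyEq analyticOnNhd_const hev
  -- By the identity theorem the function would be constant, yet its derivative at 0 is `1 / Γ(b -
  -- ν) > 0`.
  have h0 := hasDerivAt_wright hν0 hν1.le b 0
  rw [hall] at h0
  have hzero : wright 0 (-ν) (b - ν) = 0 := h0.unique (hasDerivAt_const _ _)
  have hone : wright 0 (-ν) (b - ν) = 1 / Real.Gamma (b - ν) := by
    rw [wright, tsum_eq_single 0 fun k hk ↦ by simp [hk]]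
    simp
  rw [hone] at hzero
  exact (one_div_pos.2 (Real.Gamma_pos_of_pos (sub_pos.2 hb))).ne' hzero

theorem lemmaM (α : ℝ) (hα0 : 0 < α) (hα1 : α < 1) :
    (∀ x : ℝ, 0 ≤ x → 0 < mainardi (α / 2) x) ∧
      StrictAntiOn (mainardi (α / 2)) (Set.Ici 0) := by
  have hanti : StrictAntiOn (mainardi (α / 2)) (Set.Ici 0) :=
    strictAntiOn_wright_neg (by linarith) (by linarith) (by linarith)
  refine ⟨fun x hx ↦ ?_, hanti⟩
  have hx1 : (0 : ℝ) ≤ x + 1 := by linarith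
  exact (wright_neg_nonneg (ν := α / 2) (b := 1 - α / 2) (by linarith) (by linarith)
    (by linarith) hx1).trans_lt (hanti hx hx1 (by linarith))
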